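/- All groups are abelian. For a class $\mathcal D$ of countable discrete groups, a Polish group $G$ is called quasi-$\mathcal D$ if it is (isomorphic, as a topological group, to) a subgroup of a product $\prod_{n\in\mathbb N} G_n$ with $G_n\in\mathcal D$, where the product carries the product topology and all projections $G\to G_n$ are surjective. A group is reduced if it contains no non-trivial divisible subgroup. For a prime $p$, $G$ is quasi-$p$-reduced if it is quasi-$\mathcal D$ for the class $\mathcal D$ of countable reduced $p$-groups. A bounded dsc group is a direct sum of finite cyclic groups that is annihilated by some positive integer; $G$ is quasi-bounded-dsc if it is quasi-$\mathcal D$ for the class $\mathcal D$ of countable bounded dsc groups. The rank of a $p$-group is the cardinality of a maximal independent system of elements of prime power order in it. For discrete groups $K_n$, $\prod_n K_n\le X$ means that $\prod_n K_n$ with the product topology is isomorphic, as a topological group, to a subgroup of $X$. Let $p$ be a prime and let $G$ be a non-locally compact, quasi-$p$-reduced group. (1) Either there exists an open quasi-bounded-dsc subgroup $H\le G$, or there exist a closed subgroup $L\le G$ and discrete divisible $p$-groups $K_n$, $n\in\mathbb N$, each of infinite rank, such that $\prod_n K_n\le G/L$. (2) There exist a closed subgroup $L\le G$ and infinite discrete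 groups $K_n$, $n\in\mathbb N$, such that $\prod_n K_n\le G/L$ and such that either all $K_n$ are bounded dsc groups, or all $K_n$ are divisible $p$-groups of infinite rank. -/

import Mathlib

/-! All groups are abelian and written additively. Discrete groups are algebraic groups carrying the
topology `⊥`; since they are countable wherever a family is required, they may be taken in
`Type`. -/

open scoped DirectSum

universe u

/-- `A` is divisible. -/
def IsDivisibleGroup (A : Type u) [AddCommGroup A] : Prop :=
  ∀ n : ℕ, n ≠ 0 → Function.Surjective (fun a : A => n • a)

/-- `A` is reduced: it contains no non-trivial divisible subgroup. -/
def IsReducedGroup (A : Type u) [AddCommGroup A] : Prop :=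
  ∀ B : AddSubgroup A, IsDivisibleGroup B → B = ⊥

/-- `A` is a `p`-group: every element has order a power of `p`. -/
def IsPPrimaryGroup (p : ℕ) (A : Type u) [AddCommGroup A] : Prop :=
  ∀ a : A, ∃ k : ℕ, addOrderOf a = p ^ k

/-- `A` is a reduced `p`-group. -/
def IsReducedPGroup (p : ℕ) (A : Type u) [AddCommGroup A] : Prop :=
  IsPPrimaryGroup p A ∧ IsReducedGroup A

/-- `A` is bounded: it is annihilated by a positive integer. -/
def IsBoundedGroup (A : Type u) [AddCommGroup A] : Prop :=
  ∃ N : ℕ, 0 < N ∧ ∀ a : A, N • a = 0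

/-- `A` is dsc: it is isomorphic to a direct sum of finite cyclic groups. -/
def IsDscGroup (A : Type u) [AddCommGroup A] : Prop :=
  ∃ (ι : Type u) (m : ι → ℕ), (∀ i, 0 < m i) ∧ Nonempty (A ≃+ ⨁ i, ZMod (m i))

/-- `A` is a bounded dsc group. -/
def IsBoundedDscGroup (A : Type u) [AddCommGroup A] : Prop :=
  IsBoundedGroup A ∧ IsDscGroup A

/-- A set of non-zero elements is independent if in every vanishing finite integral linear
combination of distinct elements of the set, each summand vanishes. -/
def IsIndependentSystem {A : Type u} [AddCommGroup A] (S : Set A) : Prop :=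
  0 ∉ S ∧ ∀ c : A →₀ ℤ, (c.support : Set A) ⊆ S → (c.sum fun a n => n • a) = 0 →
    ∀ a ∈ S, c a • a = 0

/-- An independent system containing only elements of prime power order. -/
def IsPrimarySystem {A : Type u} [AddCommGroup A] (S : Set A) : Prop :=
  IsIndependentSystem S ∧ ∀ a ∈ S, IsPrimePow (addOrderOf a)

/-- The rank of a `p`-group: the cardinality of a maximal independent system containing only
elements of prime power order. Such systems exist and all have the same cardinality, so the
supremum below is that common value. -/
noncomputable def groupRank (A : Type u) [AddCommGroup A] : Cardinal.{u} :=
  ⨆ S : {S : Set A // Maximal IsPrimarySystem S}, Cardinal.mk S.1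

/-- `A` is a divisible `p`-group of infinite rank. -/
def IsDivisiblePGroupOfInfiniteRank (p : ℕ) (A : Type u) [AddCommGroup A] : Prop :=
  IsPPrimaryGroup p A ∧ IsDivisibleGroup A ∧ Cardinal.aleph0 ≤ groupRank A

/-- The product topology on `∏ n, A n`, each `A n` being discrete. -/
abbrev prodDiscrete (A : ℕ → Type) : TopologicalSpace (∀ n, A n) :=
  @Pi.topologicalSpace ℕ A (fun _ => ⊥)

/-- `∏ n, A n ≤ X`: the product of the discrete groups `A n` is isomorphic, as a topological
group, to a subgroup of `X`. -/
def ProdDiscreteEmbeds (A : ℕ → Type) [∀ n, AddCommGroup (A n)]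
    (X : Type u) [AddCommGroup X] [TopologicalSpace X] : Prop :=
  ∃ f : (∀ n, A n) →+ X, @Topology.IsEmbedding _ _ (prodDiscrete A) _ f

/-- The family `A` of countable discrete groups is adequate for `G`: `G` is isomorphic, as a
topological group, to a subgroup of `∏ n, A n` all of whose projections to the `A n` are
surjective. -/
def IsAdequateFamily (A : ℕ → Type) [∀ n, AddCommGroup (A n)]
    (G : Type u) [AddCommGroup G] [TopologicalSpace G] : Prop :=
  (∀ n, Countable (A n)) ∧
    ∃ f : G →+ ∀ n, A n, @Topology.IsEmbedding _ _ _ (prodDiscrete A) f ∧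
      ∀ n, Function.Surjective fun g => f g n

/-- `G` is quasi-`D`: a Polish group with an adequate family of countable discrete groups
from the class `D`. -/
def IsQuasi (D : (A : Type) → [AddCommGroup A] → Prop)
    (G : Type u) [AddCommGroup G] [TopologicalSpace G] : Prop :=
  IsTopologicalAddGroup G ∧ PolishSpace G ∧
    ∃ (A : ℕ → Type) (_ : ∀ n, AddCommGroup (A n)),
      (∀ n, D (A n)) ∧ IsAdequateFamily A G

/-- `G` is quasi-`p`-reduced. -/
def IsQuasiPReduced (p : ℕ) (G : Type u) [AddCommGroup G] [TopologicalSpace G] : Prop :=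
  IsQuasi (fun A _ => IsReducedPGroup p A) G

/-- `G` is quasi-bounded-dsc. -/
def IsQuasiBoundedDsc (G : Type u) [AddCommGroup G] [TopologicalSpace G] : Prop :=
  IsQuasi (fun A _ => IsBoundedDscGroup A) G

open Topology Filter Set

/-! View `G` inside `∏ A n`. Being Polish it is closed there, and the subgroups `G_s = coordKer f s`
form a base of open neighbourhoods of `0`. The dichotomy is whether some `G_s` has bounded image in
every `A n`.

If so, these images are bounded `p`-groups, hence direct sums of cyclic groups, and `G_s` is the
open subgroup wanted. For (2), failure of local compactness gives every `G_s` an infinite image in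
some coordinate. A pigeonhole argument then builds a biorthogonal family of elements and
`ℚ/ℤ`-valued characters, whose blocks define maps `φ k` with infinite bounded images
(`exists_biorthogonal_seq`).

If not, every `G_s` has an unbounded reduced `p`-group as image in some coordinate. Such a group
maps onto a divisible `p`-group of infinite rank (`IsReducedPGroup.exists_surjective_divisible`),
and by injectivity the map extends to the whole coordinate, giving `φ k`.

In both cases `φ k` vanishes on `G_{s (k+1)}`, and `exists_prodDiscreteEmbeds_quotient` solves the
system `φ k x = d k` by successive approximation, so the product embeds in `G` modulo the common
kernel. -/

/-! ### Polish subgroups are closed. -/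

/-- `O m` collects the open sets whose trace on `X` has small diameter. At a point of every `O m`
the trace of the neighbourhood filter is Cauchy, and its limit in `X` maps to that point. -/
theorem isGδ_range_of_isEmbedding_of_denseRange {X Y : Type*} [TopologicalSpace X]
    [TopologicalSpace.IsCompletelyMetrizableSpace X] [TopologicalSpace Y] [T2Space Y] {e : X → Y}
    (he : IsEmbedding e) (hd : DenseRange e) : IsGδ (range e) := by
  let _ := TopologicalSpace.upgradeIsCompletelyMetrizable X
  let O : ℕ → Set Y := fun m =>
    ⋃₀ {U : Set Y | IsOpen U ∧ ∀ x y, e x ∈ U → e y ∈ U → dist x y < 1 / ((m : ℝ) + 1)}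
  have hO : ∀ m, IsOpen (O m) := fun m => isOpen_sUnion fun U hU => hU.1
  have heq : range e = ⋂ m, O m := by
    apply Subset.antisymm
    · rintro _ ⟨x, rfl⟩
      refine mem_iInter.2 fun m => ?_
      have hpos : (0 : ℝ) < 1 / ((m : ℝ) + 1) / 2 := by positivity
      obtain ⟨U, hU, hUe⟩ := he.isOpen_iff.1 (Metric.isOpen_ball (x := x)
        (ε := 1 / ((m : ℝ) + 1) / 2))
      refine ⟨U, ⟨hU, fun y z hy hz => ?_⟩, ?_⟩
      · have hy' : y ∈ Metric.ball x (1 / ((m : ℝ) + 1) / 2) := hUe ▸ hy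
        have hz' : z ∈ Metric.ball x (1 / ((m : ℝ) + 1) / 2) := hUe ▸ hz
        have := dist_triangle_right y z x
        rw [Metric.mem_ball] at hy' hz'
        linarith
      · have : x ∈ e ⁻¹' U := hUe ▸ Metric.mem_ball_self hpos
        exact this
    · intro y hy
      have hne : (comap e (𝓝 y)).NeBot := IsDenseInducing.comap_nhds_neBot ⟨he.isInducing, hd⟩ y
      have hc : Cauchy (comap e (𝓝 y)) := by
        refine Metric.cauchy_iff.2 ⟨hne, fun ε hε => ?_⟩
        obtain ⟨m, hm⟩ := exists_nat_one_div_lt hε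
        obtain ⟨U, ⟨hU, hUd⟩, hyU⟩ := mem_iInter.1 hy m
        exact ⟨e ⁻¹' U, preimage_mem_comap (hU.mem_nhds hyU),
          fun a ha b hb => (hUd a b ha hb).trans hm⟩
      obtain ⟨x, hx⟩ := CompleteSpace.complete hc
      refine ⟨x, ?_⟩
      have h1 : Tendsto e (comap e (𝓝 y)) (𝓝 (e x)) :=
        (he.continuous.tendsto x).mono_left hx
      exact tendsto_nhds_unique h1 tendsto_comap
  rw [heq]
  exact .iInter_of_isOpen hO

/-- A Polish subgroup of a Polish group is closed. -/
theorem isClosed_range_of_isEmbedding_of_polishSpace {G X : Type*} [AddCommGroup G]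
    [TopologicalSpace G] [PolishSpace G] [AddCommGroup X] [TopologicalSpace X]
    [IsTopologicalAddGroup X] [PolishSpace X] (f : G →+ X) (hf : IsEmbedding f) :
    IsClosed (range f) := by
  let C : AddSubgroup X := f.range.topologicalClosure
  have hC : IsClosed (C : Set X) := f.range.isClosed_topologicalClosure
  have : PolishSpace C := hC.polishSpace
  have hfC : ∀ g, f g ∈ C := fun g => f.range.le_topologicalClosure ⟨g, rfl⟩
  let e : G → C := fun g => ⟨f g, hfC g⟩
  have he : IsEmbedding e := hf.codRestrict C hfC
  have hd : DenseRange e := by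
    intro c
    rw [closure_subtype]
    have hr : ((↑) : C → X) '' range e = range f := by
      rw [← range_comp]; rfl
    change (c : X) ∈ closure (((↑) : C → X) '' range e)
    rw [hr]
    exact c.2
  have hG : IsGδ (range e) := isGδ_range_of_isEmbedding_of_denseRange he hd
  let _ := TopologicalSpace.upgradeIsCompletelyMetrizable C
  have hB : BaireSpace C := inferInstance
  have hsub : ∀ c ∈ C, c ∈ range f := by
    intro c hc
    -- By Baire, the dense Gδ subgroup meets its translate by `-c`, which puts `c` in the subgroup.
    let h : C ≃ₜ C := Homeomorph.addLeft (⟨c, hc⟩ : C)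
    have hG' : IsGδ (h ⁻¹' range e) := hG.preimage h.continuous
    have hd' : Dense (h ⁻¹' range e) := Dense.preimage hd h.isOpenMap
    obtain ⟨x, ⟨a, ha⟩, ⟨b, hb⟩⟩ := (Dense.inter_of_Gδ hG hG' hd hd').nonempty
    refine ⟨b - a, ?_⟩
    have h1 : f a = x := congrArg Subtype.val ha
    have h2 : f b = c + x := congrArg Subtype.val hb
    rw [map_sub, h1, h2, add_sub_cancel_right]
  have : range f = C := Subset.antisymm (by rintro _ ⟨g, rfl⟩; exact hfC g) hsub
  rw [this]
  exact hC

/-! ### Coordinate kernels as a neighbourhood base at zero. -/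

/-- The subgroup of all `g` such that the first `s` coordinates of `f g` vanish. -/
def coordKer {G : Type*} [AddCommGroup G] {A : ℕ → Type*} [∀ n, AddCommGroup (A n)]
    (f : G →+ ∀ n, A n) (s : ℕ) : AddSubgroup G where
  carrier := {g | ∀ i < s, f g i = 0}
  zero_mem' := fun i _ => by simp
  add_mem' := fun {a b} ha hb i hi => by simp [ha i hi, hb i hi]
  neg_mem' := fun {a} ha i hi => by simp [ha i hi]

section coordKer

variable {G : Type*} [AddCommGroup G] {A : ℕ → Type*} [∀ n, AddCommGroup (A n)]
  {f : G →+ ∀ n, A n}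

theorem mem_coordKer {s : ℕ} {g : G} : g ∈ coordKer f s ↔ ∀ i < s, f g i = 0 := Iff.rfl

theorem coordKer_antitone : Antitone (coordKer f) :=
  fun _ _ hst _ hg i hi => hg i (hi.trans_le hst)

variable [∀ n, TopologicalSpace (A n)]

/-- Convergence of a series with terms tending to `0`: each coordinate of the partial sums is
eventually constant, and the limit stays in the closed range. -/
theorem exists_sub_sum_mem_coordKer (hc : IsClosed (range f)) {s : ℕ → ℕ}
    (hs : StrictMono s) {g : ℕ → G} (hg : ∀ k, g k ∈ coordKer f (s k)) :
    ∃ x, ∀ k, x - ∑ i ∈ Finset.range k, g i ∈ coordKer f (s k) := by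
  have key : ∀ k m, k ≤ m → ∀ i < s k,
      f (∑ l ∈ Finset.range m, g l) i = f (∑ l ∈ Finset.range k, g l) i := by
    intro k m hkm i hi
    induction m, hkm using Nat.le_induction with
    | base => rfl
    | succ m hkm ih =>
      rw [Finset.sum_range_succ, map_add, Pi.add_apply, ih,
        hg m i (hi.trans_le (hs.monotone hkm)), add_zero]
  have hlt : ∀ i, i < s (i + 1) := fun i => hs.le_apply
  have hmem : (fun i => f (∑ l ∈ Finset.range (i + 1), g l) i) ∈ range f := by
    refine hc.mem_of_tendsto (b := atTop) (f := fun m => f (∑ l ∈ Finset.range m, g l)) ?_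
      (Eventually.of_forall fun m => ⟨_, rfl⟩)
    refine tendsto_pi_nhds.2 fun i => tendsto_const_nhds.congr' ?_
    filter_upwards [eventually_ge_atTop (i + 1)] with m hm
    exact (key (i + 1) m hm i (hlt i)).symm
  obtain ⟨x, hx⟩ := hmem
  refine ⟨x, fun k i hi => ?_⟩
  rw [map_sub, hx, Pi.sub_apply, sub_eq_zero,
    ← key (i + 1) _ (le_max_left _ k) i (hlt i), ← key k _ (le_max_right _ _) i hi]

variable [TopologicalSpace G]

theorem isOpen_coordKer [∀ n, DiscreteTopology (A n)] (hf : Continuous f) (s : ℕ) :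
    IsOpen (coordKer f s : Set G) := by
  have : (coordKer f s : Set G) = ⋂ i ∈ Set.Iio s, (fun g => f g i) ⁻¹' {0} := by
    ext g; simp [mem_coordKer]
  rw [this]
  exact (finite_Iio s).isOpen_biInter fun i _ =>
    (isOpen_discrete _).preimage ((continuous_apply i).comp hf)

theorem exists_coordKer_subset (hf : IsEmbedding f) {U : Set G} (hU : U ∈ 𝓝 0) :
    ∃ s, (coordKer f s : Set G) ⊆ U := by
  rw [hf.nhds_eq_comap, mem_comap] at hU
  obtain ⟨V, hV, hVU⟩ := hU
  rw [map_zero, nhds_pi, Filter.mem_pi] at hV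
  obtain ⟨I, hI, t, ht, hIV⟩ := hV
  obtain ⟨b, hb⟩ := hI.bddAbove
  refine ⟨b + 1, fun g hg => hVU (hIV fun i hi => ?_)⟩
  have h0 : f g i = 0 := hg i (Nat.lt_succ_of_le (hb hi))
  rw [h0]
  exact mem_of_mem_nhds (ht i)

end coordKer

/-! ### Products of discrete groups inside quotients. -/

/-- Homomorphisms `φ k` which vanish far out in a complete group and are triangular with respect to
small subgroups `W k` exhibit the product of the discrete groups `φ k (W k)` inside a quotient. -/
theorem exists_prodDiscreteEmbeds_quotient {G : Type*} [AddCommGroup G] [TopologicalSpace G]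
    [IsTopologicalAddGroup G] {A : ℕ → Type} [∀ n, AddCommGroup (A n)]
    [∀ n, TopologicalSpace (A n)] [∀ n, DiscreteTopology (A n)] {f : G →+ ∀ n, A n}
    (hf : IsEmbedding f) (hc : IsClosed (range f)) {s : ℕ → ℕ} (hs : StrictMono s)
    {D : ℕ → Type} [∀ k, AddCommGroup (D k)] (φ : ∀ k, G →+ D k)
    (hφ : ∀ k, coordKer f (s (k + 1)) ≤ (φ k).ker) (W : ℕ → AddSubgroup G)
    (hW : ∀ k, W k ≤ coordKer f (s k))
    (hWφ : ∀ j k, j < k → (W j).map (φ k) ≤ (W k).map (φ k)) :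
    ∃ L : AddSubgroup G, IsClosed (L : Set G) ∧
      ProdDiscreteEmbeds (fun k => (W k).map (φ k)) (G ⧸ L) := by
  let Φ : G →+ ∀ k, D k := AddMonoidHom.pi φ
  let _ : ∀ k, TopologicalSpace (D k) := fun _ => ⊥
  have : ∀ k, DiscreteTopology (D k) := fun _ => ⟨rfl⟩
  have hφc : ∀ k, Continuous (φ k) := fun k =>
    continuous_of_continuousAt_zero _ <| by
      rw [ContinuousAt, map_zero, nhds_discrete (D k), tendsto_pure]
      filter_upwards [(isOpen_coordKer hf.continuous (s (k + 1))).mem_nhds (zero_mem _)] with x hx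
      exact hφ k hx
  have hΦ : Continuous Φ := continuous_pi hφc
  have solve : ∀ (d : ∀ k, (W k).map (φ k)) (r : ℕ), (∀ j < r, d j = 0) →
      ∃ x ∈ coordKer f (s r), ∀ k, φ k x = d k := by
    intro d r hd
    -- The correction is `0` when equation `k` already holds; hence the partial sums vanish up to
    -- `r`, and the solution lies in `coordKer f (s r)`.
    have step : ∀ k x, ∃ g ∈ W k, (φ k x ∈ (W k).map (φ k) → φ k (x + g) = d k) ∧
        (φ k x = d k → g = 0) := by
      intro k x
      by_cases hx : φ k x = d k
      · exact ⟨0, zero_mem _, fun _ => by simpa using hx, fun _ => rfl⟩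
      by_cases hx' : φ k x ∈ (W k).map (φ k)
      · obtain ⟨g, hg, hgx⟩ := sub_mem (d k).2 hx'
        exact ⟨g, hg, fun _ => by rw [map_add, hgx, add_sub_cancel], fun h => absurd h hx⟩
      · exact ⟨0, zero_mem _, fun h => absurd h hx', fun _ => rfl⟩
    choose γ hγW hγ hγ0 using step
    let S : ℕ → G := fun k => Nat.rec 0 (fun k x => x + γ k x) k
    have hS : ∀ k, S (k + 1) = S k + γ k (S k) := fun k => rfl
    have hSsum : ∀ k, S k = ∑ i ∈ Finset.range k, γ i (S i) := by
      intro k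
      induction k with
      | zero => rfl
      | succ k ih => rw [Finset.sum_range_succ, ← ih, hS]
    have hSm : ∀ k j, k ≤ j → φ j (S k) ∈ (W j).map (φ j) := by
      intro k
      induction k with
      | zero => intro j _; simp [S]
      | succ k ih =>
        intro j hj
        rw [hS, map_add]
        exact add_mem (ih j (by omega)) (hWφ k j hj ⟨_, hγW _ _, rfl⟩)
    have hS0 : ∀ k ≤ r, S k = 0 := by
      intro k
      induction k with
      | zero => intro _; rfl
      | succ k ih =>
        intro hk
        rw [hS, hγ0, ih (by omega), add_zero]
        rw [ih (by omega), hd k hk, map_zero]; rfl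
    obtain ⟨x, hx⟩ := exists_sub_sum_mem_coordKer hc hs fun k => hW k (hγW k (S k))
    simp only [← hSsum] at hx
    refine ⟨x, by simpa [hS0 r le_rfl] using hx r, fun k => ?_⟩
    have h1 : φ k (x - S (k + 1)) = 0 := hφ k (hx (k + 1))
    rw [map_sub, sub_eq_zero] at h1
    rw [h1, hS, hγ k _ (hSm k k le_rfl)]
  refine ⟨Φ.ker, isClosed_singleton.preimage hΦ, ?_⟩
  have hΦ' : Continuous (QuotientAddGroup.kerLift Φ) := by
    exact continuous_quot_lift _ hΦ
  let ι : (∀ k, (W k).map (φ k)) →+ ∀ k, D k :=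
    AddMonoidHom.pi fun k => ((W k).map (φ k)).subtype.comp (Pi.evalAddMonoidHom _ k)
  have hex : ∀ d, ∃ q, QuotientAddGroup.kerLift Φ q = ι d := by
    intro d
    obtain ⟨x, -, hx⟩ := solve d 0 (by simp)
    exact ⟨(x : G ⧸ Φ.ker), funext hx⟩
  choose F hF using hex
  have hinj := QuotientAddGroup.kerLift_injective Φ
  let F' : (∀ k, (W k).map (φ k)) →+ G ⧸ Φ.ker :=
    AddMonoidHom.mk' F fun a b => hinj (by rw [map_add, hF, hF, hF, map_add])
  refine ⟨F', ?_⟩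
  have hpt : prodDiscrete (fun k => (W k).map (φ k)) = Pi.topologicalSpace := by
    refine congrArg (@Pi.topologicalSpace ℕ _) (funext fun k => ?_)
    exact (DiscreteTopology.eq_bot (α := (W k).map (φ k))).symm
  rw [hpt]
  have hιe : IsEmbedding ι := by
    exact IsEmbedding.piMap fun k => IsEmbedding.subtypeVal
  -- A target vanishing below `r` has a solution in `coordKer f (s r)`, so small targets have small
  -- preimages.
  have hcF : Continuous F' := by
    refine continuous_of_continuousAt_zero F' ?_
    rw [ContinuousAt, map_zero]
    intro U hU
    have hU' : ((↑) : G → G ⧸ Φ.ker) ⁻¹' U ∈ 𝓝 (0 : G) :=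
      QuotientAddGroup.continuous_mk.continuousAt.preimage_mem_nhds hU
    obtain ⟨r, hr⟩ := exists_coordKer_subset hf hU'
    have hO := isOpen_coordKer (f := AddMonoidHom.id (∀ k, (W k).map (φ k))) continuous_id r
    rw [mem_map]
    filter_upwards [hO.mem_nhds (zero_mem _)] with d hd
    rw [mem_preimage]
    obtain ⟨x, hxr, hx⟩ := solve d r hd
    have : F' d = (x : G ⧸ Φ.ker) := hinj ((hF d).trans (funext fun k => (hx k).symm))
    rw [this]
    exact hr (coordKer_antitone hs.le_apply hxr)
  refine IsEmbedding.of_comp hcF hΦ' ?_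
  have : QuotientAddGroup.kerLift Φ ∘ F' = ι := funext hF
  rw [this]
  exact hιe

/-! ### Injectivity of divisible groups and the torsion of `ℚ/ℤ`. -/

theorem IsDivisibleGroup.exists_extension {A D : Type*} [AddCommGroup A] [AddCommGroup D]
    (hD : IsDivisibleGroup D) (B : AddSubgroup A) (h : B →+ D) :
    ∃ θ : A →+ D, ∀ b : B, θ b = h b := by
  let _ : DivisibleBy D ℕ := divisibleByOfSMulRightSurj D ℕ fun {n} hn => hD n hn
  let _ : DivisibleBy D ℤ := AddGroup.divisibleByIntOfDivisibleByNat D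
  obtain ⟨θ, hθ⟩ := Module.Baer.extension_property_addMonoidHom (Module.Baer.of_divisible D)
    B.subtype B.subtype_injective h
  exact ⟨θ, fun b => DFunLike.congr_fun hθ b⟩

/-- `ℚ/ℤ` can replace the Prüfer group throughout, as the image of a `p`-group is again a `p`-group.
-/
theorem isDivisibleGroup_addCircle : IsDivisibleGroup (AddCircle (1 : ℚ)) := fun n hn x =>
  ⟨DivisibleBy.div x (n : ℤ), by
    have := DivisibleBy.div_cancel (α := ℤ) x (Int.natCast_ne_zero.2 hn)
    simpa using this⟩

theorem IsDivisibleGroup.finsupp {ι D : Type*} [AddCommGroup D] (hD : IsDivisibleGroup D) :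
    IsDivisibleGroup (ι →₀ D) := by
  intro n hn x
  induction x using Finsupp.induction_linear with
  | zero => exact ⟨0, smul_zero n⟩
  | add x y hx hy =>
    obtain ⟨a, rfl⟩ := hx
    obtain ⟨b, rfl⟩ := hy
    exact ⟨a + b, smul_add n a b⟩
  | single i d =>
    obtain ⟨c, rfl⟩ := hD n hn d
    exact ⟨Finsupp.single i c, Finsupp.smul_single n i c⟩

/-- The embedding of `ℤ/q` onto the `q`-torsion of `ℚ/ℤ`. -/
noncomputable def zmodToCircle (q : ℕ) : ZMod q →+ AddCircle (1 : ℚ) :=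
  ZMod.lift q ⟨zmultiplesHom _ (((1 : ℚ) / q : ℚ) : AddCircle (1 : ℚ)), by
    rw [zmultiplesHom_apply, natCast_zsmul, ← AddCircle.coe_nsmul]
    rcases Nat.eq_zero_or_pos q with rfl | hq
    · simp
    · have : q • ((1 : ℚ) / q) = 1 := by
        rw [nsmul_eq_mul]; field_simp
      rw [this, AddCircle.coe_period]⟩

theorem zmodToCircle_intCast (q : ℕ) (m : ℤ) :
    zmodToCircle q m = m • (((1 : ℚ) / q : ℚ) : AddCircle (1 : ℚ)) := by
  simp [zmodToCircle]

theorem zmodToCircle_injective {q : ℕ} (hq : 0 < q) : Function.Injective (zmodToCircle q) := by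
  rw [injective_iff_map_eq_zero]
  intro a ha
  obtain ⟨m, rfl⟩ := ZMod.intCast_surjective a
  rw [zmodToCircle_intCast, ← addOrderOf_dvd_iff_zsmul_eq_zero,
    AddCircle.addOrderOf_period_div hq] at ha
  exact (ZMod.intCast_zmod_eq_zero_iff_dvd m q).2 ha

theorem exists_zmodToCircle_eq {q : ℕ} (hq : 0 < q) {x : AddCircle (1 : ℚ)} (hx : q • x = 0) :
    ∃ a, zmodToCircle q a = x := by
  obtain ⟨m, -, hm⟩ := (AddCircle.nsmul_eq_zero_iff hq).1 hx
  refine ⟨(m : ℤ), ?_⟩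
  rw [zmodToCircle_intCast, ← hm, ← AddCircle.coe_zsmul]
  congr 1
  simp
  ring

theorem exists_mapRange_zmodToCircle_eq {ι : Type*} {q : ℕ} (hq : 0 < q)
    {x : ι →₀ AddCircle (1 : ℚ)} (hx : q • x = 0) :
    ∃ v : ι →₀ ZMod q, Finsupp.mapRange.addMonoidHom (zmodToCircle q) v = x := by
  have h : ∀ i, ∃ a, zmodToCircle q a = x i := fun i =>
    exists_zmodToCircle_eq hq (by simpa using DFunLike.congr_fun hx i)
  choose g hg using h
  refine ⟨Finsupp.onFinset x.support g fun i hi => Finsupp.mem_support_iff.2 fun h0 => hi ?_, ?_⟩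
  · exact zmodToCircle_injective hq (by rw [hg, h0, map_zero])
  · ext i
    simp [hg]

/-- Independent elements of prime order can be mapped to the standard elements of order `p` in a
direct sum of copies of `ℚ/ℤ`. -/
theorem exists_hom_apply_linearCombination {p : ℕ} [Fact p.Prime] {A ι : Type*} [AddCommGroup A]
    (B : AddSubgroup A) [Module (ZMod p) B] {z : ι → B} (hz : LinearIndependent (ZMod p) z) :
    ∃ θ : A →+ (ι →₀ AddCircle (1 : ℚ)), ∀ c, θ (Finsupp.linearCombination (ZMod p) z c) =
      Finsupp.mapRange.addMonoidHom (zmodToCircle p) c := by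
  obtain ⟨g, hg⟩ := (Finsupp.linearCombination (ZMod p) z).exists_leftInverse_of_injective
    (LinearMap.ker_eq_bot.2 hz)
  obtain ⟨θ, hθ⟩ := (isDivisibleGroup_addCircle.finsupp (ι := ι)).exists_extension B
    ((Finsupp.mapRange.addMonoidHom (zmodToCircle p)).comp g.toAddMonoidHom)
  refine ⟨θ, fun c => ?_⟩
  have : g (Finsupp.linearCombination (ZMod p) z c) = c := LinearMap.congr_fun hg c
  rw [hθ, AddMonoidHom.comp_apply, LinearMap.toAddMonoidHom_coe, this]

/-! ### Heights and divisibility in `p`-groups. -/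

theorem IsPPrimaryGroup.exists_pow_smul_eq_zero {p : ℕ} {A : Type*} [AddCommGroup A]
    (hA : IsPPrimaryGroup p A) (a : A) : ∃ k, p ^ k • a = 0 := by
  obtain ⟨k, hk⟩ := hA a
  exact ⟨k, hk ▸ addOrderOf_nsmul_eq_zero a⟩

theorem isPPrimaryGroup_of_forall {p : ℕ} (hp : p.Prime) {A : Type*} [AddCommGroup A]
    (hA : ∀ a : A, ∃ k, p ^ k • a = 0) : IsPPrimaryGroup p A := fun a => by
  obtain ⟨k, hk⟩ := hA a
  obtain ⟨l, -, hl⟩ := (Nat.dvd_prime_pow hp).1 (addOrderOf_dvd_of_nsmul_eq_zero hk)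
  exact ⟨l, hl⟩

theorem IsPPrimaryGroup.of_injective {p : ℕ} {A B : Type*} [AddCommGroup A] [AddCommGroup B]
    (hA : IsPPrimaryGroup p A) (f : B →+ A) (hf : Function.Injective f) :
    IsPPrimaryGroup p B := fun b => by
  rw [← addOrderOf_injective f hf]; exact hA _

theorem IsPPrimaryGroup.of_surjective {p : ℕ} (hp : p.Prime) {A B : Type*} [AddCommGroup A]
    [AddCommGroup B] (hA : IsPPrimaryGroup p A) (f : A →+ B) (hf : Function.Surjective f) :
    IsPPrimaryGroup p B := isPPrimaryGroup_of_forall hp fun b => by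
  obtain ⟨a, rfl⟩ := hf b
  obtain ⟨k, hk⟩ := hA.exists_pow_smul_eq_zero a
  exact ⟨k, by rw [← map_nsmul, hk, map_zero]⟩

/-- A `p`-group in which all elements of order `p` have infinite height is divisible. -/
theorem IsPPrimaryGroup.isDivisibleGroup {p : ℕ} (hp : p.Prime) {P : Type*} [AddCommGroup P]
    (hP : IsPPrimaryGroup p P) (h : ∀ x : P, p • x = 0 → ∀ j : ℕ, ∃ y : P, p ^ j • y = x) :
    IsDivisibleGroup P := by
  have h1 : ∀ e : ℕ, ∀ x : P, p ^ e • x = 0 → ∃ y : P, p • y = x := by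
    intro e
    induction e with
    | zero => intro x hx; exact ⟨0, by simpa using hx.symm⟩
    | succ e ih =>
      intro x hx
      obtain ⟨y, hy⟩ := h (p ^ e • x) (by rw [← mul_nsmul', ← pow_succ', hx]) (e + 1)
      -- With `p ^ e • x = p ^ (e + 1) • y`, the element `x - p • y` is killed by `p ^ e`.
      obtain ⟨y', hy'⟩ := ih (x - p • y) (by
        rw [smul_sub, ← hy, ← mul_nsmul', ← pow_succ, sub_self])
      exact ⟨y + y', by rw [smul_add, hy', add_sub_cancel]⟩
  have h2 : ∀ (j : ℕ) (x : P), ∃ y : P, p ^ j • y = x := by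
    intro j
    induction j with
    | zero => intro x; exact ⟨x, by simp⟩
    | succ j ih =>
      intro x
      obtain ⟨y, rfl⟩ := ih x
      obtain ⟨e, he⟩ := hP.exists_pow_smul_eq_zero y
      obtain ⟨w, rfl⟩ := h1 e y he
      exact ⟨w, by rw [pow_succ, mul_nsmul']⟩
  intro n hn x
  obtain ⟨a, m, hm, rfl⟩ := Nat.exists_eq_pow_mul_and_not_dvd hn p hp.ne_one
  obtain ⟨y, rfl⟩ := h2 a x
  obtain ⟨k, hk⟩ := hP y
  obtain ⟨c, hc⟩ := exists_nsmul_eq_self_of_coprime (x := y) (n := m) (by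
    rw [hk]; exact ((Nat.Prime.coprime_iff_not_dvd hp).2 hm).symm.pow_right k)
  refine ⟨c • y, ?_⟩
  change (p ^ a * m) • c • y = _
  rw [mul_nsmul', smul_comm m c y, hc]

/-- In an unbounded reduced `p`-group, there are infinitely many elements of order `p` and of
height at least `m`. -/
theorem IsReducedPGroup.infinite_setOf_height {p : ℕ} (hp : p.Prime) {M : Type*} [AddCommGroup M]
    (hM : IsReducedPGroup p M) (hb : ¬ IsBoundedGroup M) (m : ℕ) :
    {x : M | p • x = 0 ∧ ∃ y : M, p ^ m • y = x}.Infinite := by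
  intro hfin
  let S : ℕ → Set M := fun j => {x : M | p • x = 0 ∧ ∃ y : M, p ^ (m + j) • y = x}
  have hS : ∀ i j, S (i + j) ⊆ S i := by
    rintro i j x ⟨hx, y, rfl⟩
    exact ⟨hx, p ^ j • y, by rw [← mul_nsmul', ← pow_add, add_assoc]⟩
  have hSf : ∀ i, (S i).Finite := fun i => hfin.subset (by
    have := hS 0 i
    rwa [zero_add] at this)
  -- The decreasing finite sets `S j` stabilise at the least cardinality. From there on `p ^ (m + j)
  -- M` is divisible, hence zero, so `M` would be bounded.
  let j := Function.argmin fun j => (S j).ncard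
  have hj : ∀ i, S (j + i) = S j := fun i =>
    Set.eq_of_subset_of_ncard_le (hS j i) (Function.argmin_le (fun j => (S j).ncard) _) (hSf j)
  let B : AddSubgroup M := (nsmulAddMonoidHom (α := M) (p ^ (m + j))).range
  have hB : IsDivisibleGroup B := by
    refine (hM.1.of_injective B.subtype B.subtype_injective).isDivisibleGroup hp ?_
    rintro ⟨_, w, rfl⟩ hx i
    have hx' : p ^ (m + j) • w ∈ S j := ⟨congrArg Subtype.val hx, w, rfl⟩
    rw [← hj i] at hx'
    obtain ⟨-, y, hy⟩ := hx'
    refine ⟨⟨p ^ (m + j) • y, y, rfl⟩, Subtype.ext ?_⟩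
    change p ^ i • p ^ (m + j) • y = p ^ (m + j) • w
    rw [← mul_nsmul', ← pow_add, ← hy]
    congr 2
    omega
  refine hb ⟨p ^ (m + j), pow_pos hp.pos _, fun a => ?_⟩
  have : p ^ (m + j) • a ∈ B := ⟨a, rfl⟩
  rwa [hM.2 B hB, AddSubgroup.mem_bot] at this

/-! ### Infinite rank and divisible quotients. -/

theorem aleph0_le_groupRank {A : Type*} [AddCommGroup A] {S : Set A} (hS : IsPrimarySystem S)
    (hinf : S.Infinite) : Cardinal.aleph0 ≤ groupRank A := by
  obtain ⟨T, hST, hT⟩ := zorn_subset_nonempty {S : Set A | IsPrimarySystem S} (by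
    intro c hc hchain hne
    refine ⟨⋃₀ c, ⟨⟨?_, ?_⟩, ?_⟩, fun s hs => subset_sUnion_of_mem hs⟩
    · rintro ⟨s, hs, h0⟩
      exact (hc hs).1.1 h0
    · intro a ha hsum x hx
      obtain ⟨s, hs, hxs⟩ := hx
      obtain ⟨t, ht, hat⟩ := DirectedOn.exists_mem_subset_of_finite_of_subset_sUnion hne
        hchain.directedOn a.support.finite_toSet ha
      by_cases hxa : x ∈ a.support
      · exact (hc ht).1.2 a hat hsum x (hat hxa)
      · rw [Finsupp.notMem_support_iff.1 hxa, zero_smul]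
    · rintro x ⟨s, hs, hxs⟩
      exact (hc hs).2 x hxs) S hS
  have h1 : Cardinal.aleph0 ≤ Cardinal.mk T := Cardinal.aleph0_le_mk_iff.2
    (hinf.mono hST).to_subtype
  refine h1.trans ?_
  exact le_ciSup (f := fun S : {S : Set A // Maximal IsPrimarySystem S} => Cardinal.mk S.1)
    Cardinal.bddAbove_of_small ⟨T, hT⟩

theorem linearIndependent_of_notMem_span_image_Iio {K V : Type*} [DivisionRing K] [AddCommGroup V]
    [Module K V] {z : ℕ → V} (h : ∀ m, z m ∉ Submodule.span K (z '' Iio m)) :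
    LinearIndependent K z := by
  have h1 : ∀ m, LinearIndepOn K z (Iio m) := by
    intro m
    induction m with
    | zero => simp
    | succ m ih =>
      have : Iio (m + 1) = insert m (Iio m) := by
        ext i; simp only [mem_Iio, mem_insert_iff]; omega
      rw [this, linearIndepOn_insert (by simp)]
      exact ⟨ih, h m⟩
  have h2 := linearIndepOn_iUnion_of_directed (R := K) (v := z) (s := fun m : ℕ => Iio m)
    (Monotone.directed_le fun a b hab => Iio_subset_Iio hab) h1
  rwa [iUnion_Iio, linearIndepOn_univ_iff] at h2

/-- Recursion in which each choice must avoid, or be orthogonal to, all earlier ones. -/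
theorem exists_seq_eq_image_range {α : Type*} [DecidableEq α] (g : ℕ → Finset α → α) :
    ∃ z : ℕ → α, ∀ m, z m = g m ((Finset.range m).image z) := by
  refine ⟨fun m => Nat.strongRec (motive := fun _ => α) (fun m ih => g m
    ((Finset.range m).attach.image fun i => ih i.1 (Finset.mem_range.1 i.2))) m, fun m => ?_⟩
  conv_lhs => beta_reduce; rw [Nat.strongRec_eq]
  congr 1
  ext x
  simp

/-- Over a finite field the span of finitely many vectors is finite, so an infinite set leaves it.
-/
theorem exists_linearIndependent_seq_mem {K V : Type*} [DivisionRing K] [Finite K]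
    [AddCommGroup V] [Module K V] {T : ℕ → Set V} (hT : ∀ m, (T m).Infinite) :
    ∃ z : ℕ → V, LinearIndependent K z ∧ ∀ m, z m ∈ T m := by
  classical
  have step : ∀ (m : ℕ) (t : Finset V), ∃ x ∈ T m, x ∉ Submodule.span K (t : Set V) := by
    intro m t
    have : Finite (Submodule.span K (t : Set V)) := Module.finite_of_finite K
    exact (hT m).exists_notMem_finite (toFinite (Submodule.span K (t : Set V) : Set V))
  choose g hgT hg using step
  obtain ⟨z, hz⟩ := exists_seq_eq_image_range g
  refine ⟨z, linearIndependent_of_notMem_span_image_Iio fun m => ?_, fun m => ?_⟩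
  · have h1 : z '' Iio m = ((Finset.range m).image z : Finset V) := by
      rw [Finset.coe_image, Finset.coe_range]
    rw [h1, hz m]
    exact hg _ _
  · rw [hz m]
    exact hgT _ _

/-- An unbounded reduced `p`-group has a divisible quotient of infinite rank. -/
theorem IsReducedPGroup.exists_surjective_divisible {p : ℕ} (hp : p.Prime) {M : Type*}
    [AddCommGroup M] (hM : IsReducedPGroup p M) (hb : ¬ IsBoundedGroup M) :
    ∃ (P : Type) (_ : AddCommGroup P) (ψ : M →+ P), IsDivisiblePGroupOfInfiniteRank p P ∧
      Function.Surjective ψ := by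
  have := Fact.mk hp
  let B : AddSubgroup M := (nsmulAddMonoidHom (α := M) p).ker
  let _ : Module (ZMod p) B := AddCommGroup.zmodModule fun x => Subtype.ext x.2
  obtain ⟨z, hzi, hz⟩ := exists_linearIndependent_seq_mem (K := ZMod p) (V := B)
    (T := fun m => {x | ∃ y : M, p ^ m • y = x}) fun m hfin =>
      hM.infinite_setOf_height hp hb m ((hfin.image Subtype.val).subset
        fun x hx => ⟨⟨x, hx.1⟩, hx.2, rfl⟩)
  obtain ⟨θ, hθ⟩ := exists_hom_apply_linearCombination B hzi
  -- Merging the coordinates `Nat.pair i j` over all `j` makes the `i`-th standard element of order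
  -- `p` an image of elements of arbitrarily large height. These standard elements span the socle of
  -- the image, which is therefore divisible.
  let ψ : M →+ (ℕ →₀ AddCircle (1 : ℚ)) :=
    (Finsupp.mapDomain.addMonoidHom fun m => (Nat.unpair m).1).comp θ
  have hψ : ∀ m, ψ (z m) = Finsupp.single (Nat.unpair m).1 (zmodToCircle p 1) := by
    intro m
    have := hθ (Finsupp.single m 1)
    rw [Finsupp.linearCombination_single, one_smul] at this
    simp [ψ, this]
  have hψ' : ∀ i, Finsupp.single i (zmodToCircle p 1) ∈ ψ.range := fun i =>
    ⟨z (Nat.pair i 0), by rw [hψ, Nat.unpair_pair]⟩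
  have hP := hM.1.of_surjective hp ψ.rangeRestrict ψ.rangeRestrict_surjective
  refine ⟨ψ.range, inferInstance, ψ.rangeRestrict, ⟨hP, hP.isDivisibleGroup hp ?_, ?_⟩,
    ψ.rangeRestrict_surjective⟩
  · rintro ⟨x, hx⟩ hpx j
    let Q : AddSubgroup (ℕ →₀ AddCircle (1 : ℚ)) := ψ.range.map (nsmulAddMonoidHom (p ^ j))
    have hxQ : x ∈ Q := by
      rw [← Finsupp.sum_single x]
      refine sum_mem fun i _ => ?_
      have hxi : p • x i = 0 := by
        have := DFunLike.congr_fun (congrArg Subtype.val hpx) i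
        simpa using this
      obtain ⟨a, ha⟩ := exists_zmodToCircle_eq hp.pos hxi
      obtain ⟨c, rfl⟩ := ZMod.intCast_surjective a
      have hs : Finsupp.single i (x i) = c • Finsupp.single i (zmodToCircle p 1) := by
        rw [Finsupp.smul_single, ← map_zsmul, ← ha, zsmul_one]
      rw [hs]
      refine zsmul_mem ?_ c
      obtain ⟨y, hy⟩ := hz (Nat.pair i j)
      refine ⟨ψ (p ^ (Nat.pair i j - j) • y), ⟨_, rfl⟩, ?_⟩
      have := hψ (Nat.pair i j)
      rw [Nat.unpair_pair] at this
      rw [nsmulAddMonoidHom_apply, ← map_nsmul, ← mul_nsmul', ← pow_add,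
        Nat.add_sub_cancel' (Nat.right_le_pair i j), hy, this]
    obtain ⟨y, hy, hyx⟩ := hxQ
    exact ⟨⟨y, hy⟩, Subtype.ext hyx⟩
  · have hne : zmodToCircle p 1 ≠ 0 := by
      rw [Ne, ← map_zero (zmodToCircle p), (zmodToCircle_injective hp.pos).eq_iff]
      exact one_ne_zero
    have hpz : p • zmodToCircle p 1 = 0 := by
      rw [← map_nsmul]; simp
    let v : ℕ → ψ.range := fun i => ⟨Finsupp.single i (zmodToCircle p 1), hψ' i⟩
    have hv0 : ∀ i, v i ≠ 0 := fun i h => hne <| by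
      have : Finsupp.single i (zmodToCircle p 1) = 0 := congrArg Subtype.val h
      simpa using this
    have hv : Function.Injective v := fun i j hij => by
      have : Finsupp.single i (zmodToCircle p 1) = Finsupp.single j (zmodToCircle p 1) :=
        congrArg Subtype.val hij
      exact ((Finsupp.single_eq_single_iff _ _ _ _).1 this).elim And.left fun h => absurd h.1 hne
    refine aleph0_le_groupRank (S := range v) ⟨⟨?_, ?_⟩, ?_⟩ (infinite_range_of_injective hv)
    · rintro ⟨i, hi⟩
      exact hv0 i hi
    · rintro c hc hsum _ ⟨i, rfl⟩
      have h1 : ∀ a ∈ c.support, a ≠ v i → (a : ℕ →₀ AddCircle (1 : ℚ)) i = 0 := by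
        rintro a ha hai
        obtain ⟨j, rfl⟩ := hc ha
        have hji : j ≠ i := fun h => hai (h ▸ rfl)
        exact Finsupp.single_eq_of_ne' hji
      have h2 := DFunLike.congr_fun (congrArg Subtype.val hsum) i
      have h3 : (((c.sum fun a n => n • a : ψ.range) : ℕ →₀ AddCircle (1 : ℚ))) i =
          c.sum fun a n => n • (a : ℕ →₀ AddCircle (1 : ℚ)) i := by
        simp [Finsupp.sum, Finsupp.finsetSum_apply]
      rw [h3, Finsupp.sum, Finset.sum_eq_single (v i)] at h2
      · apply Subtype.ext
        have h4 : c (v i) • zmodToCircle p 1 = 0 := by simpa [v] using h2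
        change c (v i) • Finsupp.single i (zmodToCircle p 1) = 0
        rw [Finsupp.smul_single, h4, Finsupp.single_zero]
      · intro a ha hai
        rw [h1 a ha hai, smul_zero]
      · intro h
        rw [Finsupp.notMem_support_iff.1 h, zero_smul]
    · rintro _ ⟨i, rfl⟩
      have : addOrderOf (v i) = p := addOrderOf_eq_prime (Subtype.ext <| by
        change p • Finsupp.single i (zmodToCircle p 1) = 0
        rw [Finsupp.smul_single, hpz, Finsupp.single_zero]) (hv0 i)
      rw [this]
      exact hp.isPrimePow

/-! ### Bounded `p`-groups are direct sums of cyclic groups. -/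

theorem IsDscGroup.of_equiv {A B : Type u} [AddCommGroup A] [AddCommGroup B] (hA : IsDscGroup A)
    (e : B ≃+ A) : IsDscGroup B := by
  obtain ⟨ι, m, hm, ⟨f⟩⟩ := hA
  exact ⟨ι, m, hm, ⟨e.trans f⟩⟩

theorem IsDscGroup.prod {A B : Type u} [AddCommGroup A] [AddCommGroup B] (hA : IsDscGroup A)
    (hB : IsDscGroup B) : IsDscGroup (A × B) := by
  classical
  obtain ⟨ι, m, hm, ⟨f⟩⟩ := hA
  obtain ⟨κ, l, hl, ⟨g⟩⟩ := hB
  let q : ι ⊕ κ → ℕ := Sum.elim m l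
  let a' : ∀ i, ZMod (m i) →+ ⨁ k, ZMod (q k) := fun i =>
    DirectSum.of (fun k => ZMod (q k)) (Sum.inl i)
  let b' : ∀ j, ZMod (l j) →+ ⨁ k, ZMod (q k) := fun j =>
    DirectSum.of (fun k => ZMod (q k)) (Sum.inr j)
  let a := DirectSum.toAddMonoid a'
  let b := DirectSum.toAddMonoid b'
  let c : ∀ k, ZMod (q k) →+ (⨁ i, ZMod (m i)) × (⨁ j, ZMod (l j)) :=
    fun k => match k with
      | Sum.inl i => (AddMonoidHom.inl _ _).comp (DirectSum.of (fun i => ZMod (m i)) i)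
      | Sum.inr j => (AddMonoidHom.inr _ _).comp (DirectSum.of (fun j => ZMod (l j)) j)
  let F := DirectSum.toAddMonoid c
  have hF : ∀ k x, F (DirectSum.of (fun k => ZMod (q k)) k x) = c k x :=
    fun k x => DirectSum.toAddMonoid_of c k x
  have ha' : ∀ i x, a (DirectSum.of (fun i => ZMod (m i)) i x) = a' i x :=
    fun i x => DirectSum.toAddMonoid_of a' i x
  have hb' : ∀ j x, b (DirectSum.of (fun j => ZMod (l j)) j x) = b' j x :=
    fun j x => DirectSum.toAddMonoid_of b' j x
  have ha : F.comp a = AddMonoidHom.inl _ _ := DirectSum.addHom_ext fun i x => by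
    rw [AddMonoidHom.comp_apply, ha']
    exact hF (Sum.inl i) x
  have hb : F.comp b = AddMonoidHom.inr _ _ := DirectSum.addHom_ext fun j x => by
    rw [AddMonoidHom.comp_apply, hb']
    exact hF (Sum.inr j) x
  have h1 : F.comp (a.coprod b) = AddMonoidHom.id _ := by
    rw [AddMonoidHom.comp_coprod, ha, hb, AddMonoidHom.coprod_inl_inr]
  have h2 : (a.coprod b).comp F = AddMonoidHom.id _ := DirectSum.addHom_ext fun k x => by
    rw [AddMonoidHom.comp_apply, AddMonoidHom.id_apply, hF]
    rcases k with i | j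
    · change a (DirectSum.of (fun i => ZMod (m i)) i x) + b 0 = _
      rw [map_zero, add_zero, ha' i x]
      rfl
    · change a 0 + b (DirectSum.of (fun j => ZMod (l j)) j x) = _
      rw [map_zero, zero_add, hb' j x]
      rfl
  refine ⟨ι ⊕ κ, q, by rintro (i | j); exacts [hm i, hl j],
    ⟨(f.prodCongr g).trans (AddMonoidHom.toAddEquiv (a.coprod b) F h1 h2)⟩⟩

/-- A basis of `B = p ^ n A` gives `θ` from `A` onto the `p ^ (n + 1)`-torsion of a sum of copies of
`ℚ/ℤ`. That torsion is free over `ℤ/p ^ (n + 1)`, so `θ` splits off. As `θ` is injective on `B`, its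
kernel is killed by `p ^ n`. -/
theorem isDscGroup_of_pow_succ_smul_eq_zero {p : ℕ} [hp : Fact p.Prime] {n : ℕ} {A : Type u}
    [AddCommGroup A] (hA : ∀ a : A, p ^ (n + 1) • a = 0)
    (ih : ∀ C : AddSubgroup A, (∀ c : C, p ^ n • c = 0) → IsDscGroup C)
    (B : AddSubgroup A) [Module (ZMod p) B] (hB : ∀ x, x ∈ B ↔ ∃ a, p ^ n • a = x) :
    IsDscGroup A := by
  have hp := hp.out
  classical
  let κ := Module.Basis.ofVectorSpaceIndex (ZMod p) B
  let b : Module.Basis κ (ZMod p) B := Module.Basis.ofVectorSpace (ZMod p) B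
  obtain ⟨θ, hθ⟩ := exists_hom_apply_linearCombination B b.linearIndependent
  have hker : ∀ x : B, θ x = 0 → x = 0 := by
    intro x hx
    rw [← b.linearCombination_repr x] at hx ⊢
    rw [hθ] at hx
    have h0 : b.repr x = 0 := by
      ext i
      have := DFunLike.congr_fun hx i
      exact zmodToCircle_injective hp.pos (by simpa using this)
    rw [h0, map_zero]
  have hsurj : ∀ e ≤ n + 1, ∀ x, p ^ e • x = 0 → ∃ a, θ a = x := by
    intro e
    induction e with
    | zero => intro _ x hx; exact ⟨0, by simpa using hx.symm⟩
    | succ e ihe =>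
      intro he x hx
      obtain ⟨c, hc⟩ := exists_mapRange_zmodToCircle_eq hp.pos (x := p ^ e • x)
        (by rw [← mul_nsmul', ← pow_succ', hx])
      obtain ⟨w, hw⟩ := (hB _).1 (Finsupp.linearCombination (ZMod p) b c).2
      rw [← hθ, ← hw] at hc
      -- Since `p ^ e • x = θ (p ^ n • w)`, subtracting `θ (p ^ (n - e) • w)` lowers the exponent of
      -- `x`.
      obtain ⟨a, ha⟩ := ihe (by omega) (x - θ (p ^ (n - e) • w)) (by
        rw [smul_sub, ← map_nsmul, ← mul_nsmul', ← pow_add, Nat.add_sub_cancel' (by omega), ← hc]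
        exact sub_self _)
      exact ⟨a + p ^ (n - e) • w, by rw [map_add, ha, sub_add_cancel]⟩
  have hq : 0 < p ^ (n + 1) := pow_pos hp.pos _
  have hsec : ∀ i, ∃ a, θ a = Finsupp.single i (zmodToCircle (p ^ (n + 1)) 1) := fun i =>
    hsurj (n + 1) le_rfl _ (by
      rw [Finsupp.smul_single, ← map_nsmul, nsmul_one, ZMod.natCast_self, map_zero,
        Finsupp.single_zero])
  choose a ha using hsec
  let σ : (κ →₀ ZMod (p ^ (n + 1))) →+ A := Finsupp.liftAddHom fun i =>
    ZMod.lift (p ^ (n + 1)) ⟨zmultiplesHom A (a i), by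
      rw [zmultiplesHom_apply, natCast_zsmul, hA]⟩
  have hσ : ∀ v, θ (σ v) = Finsupp.mapRange.addMonoidHom (zmodToCircle (p ^ (n + 1))) v := by
    intro v
    induction v using Finsupp.induction_linear with
    | zero => simp
    | add v w hv hw => rw [map_add, map_add, map_add, hv, hw]
    | single i x =>
      obtain ⟨m, rfl⟩ := ZMod.intCast_surjective x
      have h1 : σ (Finsupp.single i (m : ZMod (p ^ (n + 1)))) = m • a i := by
        rw [Finsupp.liftAddHom_apply_single, ZMod.lift_coe]; rfl
      rw [h1, map_zsmul, ha, Finsupp.mapRange.addMonoidHom_apply, Finsupp.mapRange_single,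
        Finsupp.smul_single, ← map_zsmul, zsmul_one]
  have hbij : Function.Bijective (θ.ker.subtype.coprod σ) := by
    constructor
    · rw [injective_iff_map_eq_zero]
      rintro ⟨c, v⟩ hcv
      have h1 : (c : A) + σ v = 0 := hcv
      have h2 := congrArg θ h1
      rw [map_add, map_zero, show θ c = 0 from c.2, zero_add, hσ] at h2
      have h3 : v = 0 := by
        ext i
        have := DFunLike.congr_fun h2 i
        exact zmodToCircle_injective hq (by simpa using this)
      rw [h3, map_zero, add_zero] at h1
      exact Prod.ext (Subtype.ext h1) h3
    · intro x
      obtain ⟨v, hv⟩ := exists_mapRange_zmodToCircle_eq hq (x := θ x)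
        (by rw [← map_nsmul, hA, map_zero])
      refine ⟨(⟨x - σ v, ?_⟩, v), sub_add_cancel _ _⟩
      rw [AddMonoidHom.mem_ker, map_sub, hσ, hv, sub_self]
  have hdsc : IsDscGroup (κ →₀ ZMod (p ^ (n + 1))) :=
    ⟨κ, fun _ => p ^ (n + 1), fun _ => hq,
      ⟨(finsuppLEquivDirectSum ℤ (ZMod (p ^ (n + 1))) κ).toAddEquiv⟩⟩
  refine ((ih θ.ker fun c => ?_).prod hdsc).of_equiv (AddEquiv.ofBijective _ hbij).symm
  have h1 := hker ⟨p ^ n • (c : A), (hB _).2 ⟨c, rfl⟩⟩ (by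
    change θ (p ^ n • (c : A)) = 0
    rw [map_nsmul, show θ c = 0 from c.2, smul_zero])
  exact Subtype.ext (congrArg (fun y : B => (y : A)) h1)

theorem isDscGroup_of_pow_smul_eq_zero {p : ℕ} (hp : p.Prime) (n : ℕ) :
    ∀ {A : Type u} [AddCommGroup A], (∀ a : A, p ^ n • a = 0) → IsDscGroup A := by
  have := Fact.mk hp
  induction n with
  | zero =>
    intro A _ hA
    have : Subsingleton A := ⟨fun a b => by
      have ha := hA a
      have hb := hA b
      rw [pow_zero, one_smul] at ha hb
      rw [ha, hb]⟩
    exact ⟨PEmpty, fun _ => 1, fun _ => one_pos,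
      ⟨⟨⟨0, 0, fun _ => Subsingleton.elim _ _, fun _ => DFinsupp.ext nofun⟩,
        fun _ _ => (add_zero _).symm⟩⟩⟩
  | succ n ih =>
    intro A _ hA
    let B : AddSubgroup A := (nsmulAddMonoidHom (α := A) (p ^ n)).range
    let _ : Module (ZMod p) B := AddCommGroup.zmodModule (by
      rintro ⟨_, a, rfl⟩
      refine Subtype.ext ?_
      change p • p ^ n • a = 0
      rw [← mul_nsmul', ← pow_succ', hA])
    exact isDscGroup_of_pow_succ_smul_eq_zero hA (fun C hC => ih hC) B fun x => Iff.rfl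

/-- A bounded `p`-group is a direct sum of finite cyclic groups. -/
theorem IsPPrimaryGroup.isBoundedDscGroup {p : ℕ} (hp : p.Prime) {A : Type u} [AddCommGroup A]
    (hA : IsPPrimaryGroup p A) (hb : IsBoundedGroup A) : IsBoundedDscGroup A := by
  refine ⟨hb, ?_⟩
  obtain ⟨N, hN, hNA⟩ := hb
  -- The crude exponent `N` suffices: an element of order `p ^ k` has `k ≤ p ^ k ≤ N`.
  refine isDscGroup_of_pow_smul_eq_zero hp N fun a => ?_
  obtain ⟨k, hk⟩ := hA a
  have h1 : p ^ k ≤ N := Nat.le_of_dvd hN (hk ▸ addOrderOf_dvd_of_nsmul_eq_zero (hNA a))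
  have h2 : k ≤ N := (Nat.lt_pow_self hp.one_lt).le.trans h1
  rw [← Nat.add_sub_cancel' h2, pow_add, mul_comm, mul_nsmul', ← hk, addOrderOf_nsmul_eq_zero,
    smul_zero]

/-! ### Inheritance by subgroups, quotients and isomorphic copies. -/

theorem IsDivisibleGroup.of_surjective {A B : Type*} [AddCommGroup A] [AddCommGroup B]
    (hA : IsDivisibleGroup A) (f : A →+ B) (hf : Function.Surjective f) : IsDivisibleGroup B := by
  intro n hn b
  obtain ⟨a, rfl⟩ := hf b
  obtain ⟨c, rfl⟩ := hA n hn a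
  exact ⟨f c, (map_nsmul f n c).symm⟩

theorem IsReducedGroup.addSubgroup {A : Type*} [AddCommGroup A] (hA : IsReducedGroup A)
    (M : AddSubgroup A) : IsReducedGroup M := by
  intro B hB
  have h := hA (B.map M.subtype)
    (hB.of_surjective (M.subtype.addSubgroupMap B) (M.subtype.addSubgroupMap_surjective B))
  exact (AddSubgroup.map_eq_bot_iff_of_injective B M.subtype_injective).1 h

theorem IsReducedPGroup.addSubgroup {p : ℕ} {A : Type*} [AddCommGroup A]
    (hA : IsReducedPGroup p A) (M : AddSubgroup A) : IsReducedPGroup p M :=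
  ⟨hA.1.of_injective M.subtype M.subtype_injective, hA.2.addSubgroup M⟩

theorem prodDiscrete_eq (K : ℕ → Type) [∀ k, TopologicalSpace (K k)]
    [∀ k, DiscreteTopology (K k)] : prodDiscrete K = Pi.topologicalSpace :=
  congrArg (@Pi.topologicalSpace ℕ _) (funext fun _ => DiscreteTopology.eq_bot.symm)

theorem ProdDiscreteEmbeds.congr {X : Type*} [AddCommGroup X] [TopologicalSpace X]
    {K K' : ℕ → Type} [∀ k, AddCommGroup (K k)] [∀ k, AddCommGroup (K' k)]
    (h : ProdDiscreteEmbeds K X) (e : ∀ k, K' k ≃+ K k) : ProdDiscreteEmbeds K' X := by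
  obtain ⟨f, hf⟩ := h
  let _ : ∀ k, TopologicalSpace (K k) := fun _ => ⊥
  let _ : ∀ k, TopologicalSpace (K' k) := fun _ => ⊥
  have : ∀ k, DiscreteTopology (K k) := fun _ => ⟨rfl⟩
  have : ∀ k, DiscreteTopology (K' k) := fun _ => ⟨rfl⟩
  refine ⟨f.comp (AddEquiv.piCongrRight e).toAddMonoidHom, ?_⟩
  have he : IsEmbedding (Pi.map fun k => e k) := IsEmbedding.piMap fun k =>
    (IsClosedEmbedding.of_continuous_injective_isClosedMap continuous_of_discreteTopology
      (e k).injective fun _ _ => isClosed_discrete _).isEmbedding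
  have := IsEmbedding.comp hf he
  exact this

/-! ### The unbounded case, and the open subgroup in the bounded case. -/

section

variable {G : Type*} [AddCommGroup G] {A : ℕ → Type} [∀ n, AddCommGroup (A n)]

/-- The `n`-th coordinate of a homomorphism into a product. -/
def coordHom (f : G →+ ∀ n, A n) (n : ℕ) : G →+ A n := (Pi.evalAddMonoidHom A n).comp f

theorem coordKer_le_ker_coordHom (f : G →+ ∀ n, A n) {n s : ℕ} (h : n < s) :
    coordKer f s ≤ (coordHom f n).ker := fun _ hg => hg n h

theorem exists_strictMono_interlaced {Q : ℕ → ℕ → Prop} (hQ : ∀ s, ∃ n, s ≤ n ∧ Q s n) (s₀ : ℕ) :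
    ∃ s n : ℕ → ℕ, s 0 = s₀ ∧ StrictMono s ∧ (∀ k, n k < s (k + 1)) ∧ ∀ k, Q (s k) (n k) := by
  choose N hN hQN using hQ
  let s : ℕ → ℕ := fun k => Nat.rec s₀ (fun _ t => N t + 1) k
  exact ⟨s, fun k => N (s k), rfl, strictMono_nat_of_lt_succ fun k => Nat.lt_succ_of_le (hN (s k)),
    fun k => Nat.lt_succ_self _, fun k => hQN (s k)⟩

variable [TopologicalSpace G] [IsTopologicalAddGroup G]
    [∀ n, TopologicalSpace (A n)] [∀ n, DiscreteTopology (A n)] {f : G →+ ∀ n, A n}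

/-- Were all images finite, the open subgroup `coordKer f s` would be closed in a product of finite
sets, hence compact. -/
theorem exists_infinite_map_coordHom (hf : IsEmbedding f) (hc : IsClosed (range f))
    (hlc : ¬ LocallyCompactSpace G) (s : ℕ) :
    ∃ n, Infinite ((coordKer f s).map (coordHom f n)) := by
  by_contra! hfin
  refine hlc ?_
  have hopen := isOpen_coordKer hf.continuous s
  have hK : IsCompact (coordKer f s : Set G) := by
    rw [hf.isInducing.isCompact_iff]
    refine (isCompact_univ_pi fun n => (toFinite
      ((coordKer f s).map (coordHom f n) : Set (A n))).isCompact).of_isClosed_subset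
      ((IsClosedEmbedding.mk hf hc).isClosedMap _ ((coordKer f s).isClosed_of_isOpen hopen)) ?_
    rintro _ ⟨g, hg, rfl⟩ n -
    exact ⟨g, hg, rfl⟩
  exact hK.locallyCompactSpace_of_mem_nhds_of_addGroup (hopen.mem_nhds (zero_mem _))

theorem exists_prodDiscreteEmbeds_divisible {p : ℕ} (hp : p.Prime)
    (hA : ∀ n, IsReducedPGroup p (A n)) (hf : IsEmbedding f) (hc : IsClosed (range f))
    (hb : ∀ s, ∃ n, ¬ IsBoundedGroup ((coordKer f s).map (coordHom f n))) :
    ∃ L : AddSubgroup G, IsClosed (L : Set G) ∧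
      ∃ (K : ℕ → Type) (_ : ∀ n, AddCommGroup (K n)),
        (∀ n, IsDivisiblePGroupOfInfiniteRank p (K n)) ∧ ProdDiscreteEmbeds K (G ⧸ L) := by
  have hb' : ∀ s, ∃ n, s ≤ n ∧ ¬ IsBoundedGroup ((coordKer f s).map (coordHom f n)) := by
    intro s
    obtain ⟨n, hn⟩ := hb s
    -- Coordinates below `s` vanish on `coordKer f s`, so an unbounded one has index at least `s`.
    refine ⟨n, not_lt.1 fun hlt => hn ⟨1, one_pos, ?_⟩, hn⟩
    rintro ⟨_, g, hg, rfl⟩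
    rw [one_smul]
    exact Subtype.ext (hg n hlt)
  obtain ⟨s, n, -, hs, hn, hsn⟩ := exists_strictMono_interlaced hb' 0
  choose P iP ψ hP hψ using fun k =>
    ((hA (n k)).addSubgroup ((coordKer f (s k)).map (coordHom f (n k)))).exists_surjective_divisible
      hp (hsn k)
  choose θ hθ using fun k => (hP k).2.1.exists_extension _ (ψ k)
  let φ : ∀ k, G →+ P k := fun k => (θ k).comp (coordHom f (n k))
  have hφ : ∀ k, (coordKer f (s k)).map (φ k) = ⊤ := by
    refine fun k => top_unique fun y _ => ?_
    obtain ⟨⟨_, g, hg, rfl⟩, rfl⟩ := hψ k y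
    exact ⟨g, hg, hθ k ⟨_, g, hg, rfl⟩⟩
  obtain ⟨L, hL, hLK⟩ := exists_prodDiscreteEmbeds_quotient hf hc hs φ (fun k g hg => by
      rw [AddMonoidHom.mem_ker, AddMonoidHom.comp_apply,
        coordKer_le_ker_coordHom f (hn k) hg, map_zero])
    (fun k => coordKer f (s k)) (fun k => le_rfl) (fun j k _ => by rw [hφ k]; exact le_top)
  refine ⟨L, hL, P, iP, hP, hLK.congr fun k => ?_⟩
  exact AddSubgroup.topEquiv.symm.trans (AddEquiv.addSubgroupCongr (hφ k).symm)

theorem isQuasiBoundedDsc_coordKer [PolishSpace G] {p : ℕ} (hp : p.Prime)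
    (hA : ∀ n, IsPPrimaryGroup p (A n)) [∀ n, Countable (A n)] (hf : IsEmbedding f) {s : ℕ}
    (hb : ∀ n, IsBoundedGroup ((coordKer f s).map (coordHom f n))) :
    IsQuasiBoundedDsc (coordKer f s) := by
  have hcl : IsClosed (coordKer f s : Set G) :=
    (coordKer f s).isClosed_of_isOpen (isOpen_coordKer hf.continuous s)
  refine ⟨inferInstance, hcl.polishSpace, fun n => (coordKer f s).map (coordHom f n),
    fun n => inferInstance, fun n => ?_, fun n => inferInstance,
    AddMonoidHom.pi fun n => (coordHom f n).addSubgroupMap (coordKer f s), ?_,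
    fun n => (coordHom f n).addSubgroupMap_surjective (coordKer f s)⟩
  · exact ((hA n).of_injective _ (AddSubgroup.subtype_injective _)).isBoundedDscGroup hp (hb n)
  · rw [prodDiscrete_eq]
    refine IsEmbedding.of_comp (g := Pi.map fun n => Subtype.val) ?_ ?_ ?_
    · refine continuous_pi fun n => Continuous.subtype_mk
        (((continuous_apply n).comp hf.continuous).comp continuous_subtype_val) _
    · exact Continuous.piMap fun n => continuous_subtype_val
    · exact hf.comp IsEmbedding.subtypeVal

end

/-! ### Biorthogonal families and the bounded case. -/

/-- An element and a character separating it, both orthogonal to finitely many given elements and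
characters. -/
theorem exists_character_apply_ne_zero_orthogonal {p : ℕ} (hp : p.Prime) {G A : Type*}
    [AddCommGroup G] [AddCommGroup A] (hA : IsPPrimaryGroup p A) (π : G →+ A) {N N₀ : AddSubgroup G}
    (hN : N ≤ N₀) (hinf : Infinite (N.map π)) (hb : IsBoundedGroup (N₀.map π))
    (H : Set (G × (G →+ AddCircle (1 : ℚ)))) (hH : H.Finite)
    (hHf : ∀ x ∈ H, (x.2 '' N₀).Finite) :
    ∃ x : G × (G →+ AddCircle (1 : ℚ)), (x.2 '' N₀).Finite ∧ x.1 ∈ N ∧ π.ker ≤ x.2.ker ∧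
      x.2 x.1 ≠ 0 ∧ ∀ y ∈ H, x.2 y.1 = 0 ∧ y.2 x.1 = 0 := by
  let F : AddSubgroup A := AddSubgroup.closure ((fun y => π y.1) '' H)
  have hF : (F : Set A).Finite := by
    have hfg : AddGroup.FG F := (AddGroup.fg_iff_addSubgroup_fg F).2
      ((AddSubgroup.fg_iff F).2 ⟨_, rfl, hH.image _⟩)
    have : Finite F := AddCommGroup.finite_of_fg_isAddTorsion F fun x => by
      obtain ⟨k, hk⟩ := hA.exists_pow_smul_eq_zero (x : A)
      exact isOfFinAddOrder_iff_nsmul_eq_zero.2 ⟨p ^ k, pow_pos hp.pos k, Subtype.ext hk⟩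
    exact toFinite _
  choose σ hσN hσ using fun y : N.map π => y.2
  have : Finite H := hH
  have : ∀ h : H, Finite (h.1.2 '' N₀) := fun h => hHf h.1 h.2
  -- The old characters take finitely many values on `N₀`, so infinitely many elements share all of
  -- them. A difference of two such is orthogonal to the old characters, and can be chosen outside
  -- the finite group `F` spanned by the old elements; a character of `A ⧸ F` then detects it.
  let vec : N.map π → ∀ h : H, h.1.2 '' N₀ := fun y h => ⟨h.1.2 (σ y), σ y, hN (hσN y), rfl⟩
  obtain ⟨v, hv⟩ := Finite.exists_infinite_fiber vec
  obtain ⟨y₀, hy₀⟩ := (infinite_coe_iff.1 hv).nonempty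
  obtain ⟨y, hy, hyF⟩ := (infinite_coe_iff.1 hv).exists_notMem_finite
    (t := {y : N.map π | (y : A) - y₀ ∈ F})
    (hF.preimage (f := fun y : N.map π => (y : A) - y₀)
      fun a _ b _ hab => Subtype.ext (sub_left_injective hab))
  let w := σ y - σ y₀
  have hw : (π w : A ⧸ F) ≠ 0 := by
    rw [Ne, QuotientAddGroup.eq_zero_iff, map_sub, hσ, hσ]
    exact hyF
  obtain ⟨c, hc⟩ := CharacterModule.exists_character_apply_ne_zero_of_ne_zero hw
  let c' : A →+ AddCircle (1 : ℚ) := AddMonoidHom.comp c (QuotientAddGroup.mk' F)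
  obtain ⟨M, hM, hMb⟩ := hb
  -- The new character again has finite image on `N₀`: its values there are `M`-torsion in `ℚ/ℤ`.
  refine ⟨(w, c'.comp π), ?_, sub_mem (hσN _) (hσN _), fun g hg => ?_, hc, fun x hx => ⟨?_, ?_⟩⟩
  · refine (AddCircle.finite_torsion (1 : ℚ) hM).subset ?_
    rintro _ ⟨g, hg, rfl⟩
    have := congrArg Subtype.val (hMb ⟨π g, g, hg, rfl⟩)
    change M • c' (π g) = 0
    rw [← map_nsmul, show M • π g = 0 from this, map_zero]
  · rw [AddMonoidHom.mem_ker, AddMonoidHom.comp_apply, show π g = 0 from hg, map_zero]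
  · have : ((π x.1 : A) : A ⧸ F) = 0 := (QuotientAddGroup.eq_zero_iff _).2
      (AddSubgroup.subset_closure ⟨x, hx, rfl⟩)
    change c ((π x.1 : A) : A ⧸ F) = 0
    rw [this, map_zero]
  · have h1 := congrArg Subtype.val (congrFun (hy.trans hy₀.symm) ⟨x, hx⟩)
    change x.2 (σ y - σ y₀) = 0
    rw [map_sub, sub_eq_zero]
    exact h1

/-- A biorthogonal family of elements and characters, the elements becoming small and the characters
factoring through prescribed coordinates. -/
theorem exists_biorthogonal_seq {p : ℕ} (hp : p.Prime) {G : Type*} [AddCommGroup G] {A : ℕ → Type*}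
    [∀ n, AddCommGroup (A n)] (hA : ∀ n, IsPPrimaryGroup p (A n)) (π : ∀ n, G →+ A n)
    (N : ℕ → AddSubgroup G) {N₀ : AddSubgroup G} (hN : ∀ k, N k ≤ N₀)
    (hinf : ∀ k, Infinite ((N k).map (π k))) (hb : ∀ k, IsBoundedGroup (N₀.map (π k)))
    (κ : ℕ → ℕ) :
    ∃ (w : ℕ → G) (χ : ℕ → G →+ AddCircle (1 : ℚ)), (∀ m, w m ∈ N (κ m)) ∧
      (∀ m, (π (κ m)).ker ≤ (χ m).ker) ∧ (∀ m, χ m (w m) ≠ 0) ∧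
      ∀ m m', m ≠ m' → χ m (w m') = 0 := by
  classical
  let X := {x : G × (G →+ AddCircle (1 : ℚ)) // (x.2 '' N₀).Finite}
  have step : ∀ (m : ℕ) (H : Finset X), ∃ x : X, x.1.1 ∈ N (κ m) ∧ (π (κ m)).ker ≤ x.1.2.ker ∧
      x.1.2 x.1.1 ≠ 0 ∧ ∀ y ∈ H, x.1.2 y.1.1 = 0 ∧ y.1.2 x.1.1 = 0 := by
    intro m H
    obtain ⟨x, hxf, hxN, hxπ, hx0, hx⟩ := exists_character_apply_ne_zero_orthogonal hp (hA (κ m))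
      (π (κ m)) (hN (κ m)) (hinf (κ m)) (hb (κ m)) (Subtype.val '' (H : Set X))
      (H.finite_toSet.image _) (by rintro _ ⟨y, -, rfl⟩; exact y.2)
    exact ⟨⟨x, hxf⟩, hxN, hxπ, hx0, fun y hy => hx y.1 ⟨y, hy, rfl⟩⟩
  choose g hgN hgπ hg0 hg using step
  obtain ⟨z, hz⟩ := exists_seq_eq_image_range g
  have hlt : ∀ m m', m' < m → (z m).1.2 (z m').1.1 = 0 ∧ (z m').1.2 (z m).1.1 = 0 := by
    intro m m' h
    rw [hz m]
    exact hg m _ (z m') (Finset.mem_image_of_mem z (Finset.mem_range.2 h))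
  refine ⟨fun m => (z m).1.1, fun m => (z m).1.2, fun m => ?_, fun m => ?_, fun m => ?_,
    fun m m' h => ?_⟩
  · beta_reduce; rw [hz m]; exact hgN _ _
  · beta_reduce; rw [hz m]; exact hgπ _ _
  · beta_reduce; rw [hz m]; exact hg0 _ _
  · rcases h.lt_or_gt with h | h
    · exact (hlt m' m h).2
    · exact (hlt m m' h).1

theorem exists_prodDiscreteEmbeds_boundedDsc {G : Type*} [AddCommGroup G] {A : ℕ → Type}
    [∀ n, AddCommGroup (A n)] [TopologicalSpace G] [IsTopologicalAddGroup G]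
    [∀ n, TopologicalSpace (A n)] [∀ n, DiscreteTopology (A n)] {f : G →+ ∀ n, A n} {p : ℕ}
    (hp : p.Prime) (hA : ∀ n, IsPPrimaryGroup p (A n)) (hf : IsEmbedding f)
    (hc : IsClosed (range f)) (hlc : ¬ LocallyCompactSpace G) {s₀ : ℕ}
    (hb : ∀ n, IsBoundedGroup ((coordKer f s₀).map (coordHom f n))) :
    ∃ L : AddSubgroup G, IsClosed (L : Set G) ∧
      ∃ (K : ℕ → Type) (_ : ∀ n, AddCommGroup (K n)), (∀ n, Infinite (K n)) ∧
        (∀ n, IsBoundedDscGroup (K n)) ∧ ProdDiscreteEmbeds K (G ⧸ L) := by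
  have hinf : ∀ s, ∃ n, s ≤ n ∧ Infinite ((coordKer f s).map (coordHom f n)) := by
    intro s
    obtain ⟨n, hn⟩ := exists_infinite_map_coordHom hf hc hlc s
    refine ⟨n, not_lt.1 fun hlt => not_subsingleton ((coordKer f s).map (coordHom f n)) ⟨?_⟩, hn⟩
    rintro ⟨_, g, hg, rfl⟩ ⟨_, g', hg', rfl⟩
    exact Subtype.ext ((hg n hlt).trans (hg' n hlt).symm)
  obtain ⟨s, n, rfl, hs, hn, hsn⟩ := exists_strictMono_interlaced hinf s₀
  have hN : ∀ k, coordKer f (s k) ≤ coordKer f (s 0) := fun k =>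
    coordKer_antitone (hs.monotone (Nat.zero_le k))
  obtain ⟨w, χ, hw, hχ, hχ0, hχw⟩ := exists_biorthogonal_seq hp (fun k => hA (n k))
    (fun k => coordHom f (n k)) (fun k => coordKer f (s k)) hN hsn (fun k => hb (n k))
    fun m => (Nat.unpair m).1
  -- One sequence is cut into infinitely many infinite blocks: index `Nat.pair k i` belongs to
  -- coordinate `n k`. Biorthogonality makes `φ k` kill `W j` for `j ≠ k` and keeps the `φ k`-images
  -- of the generators of `W k` distinct.
  let φ : ℕ → G →+ (ℕ → AddCircle (1 : ℚ)) := fun k => AddMonoidHom.pi fun i => χ (Nat.pair k i)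
  let W : ℕ → AddSubgroup G := fun k => AddSubgroup.closure (range fun i => w (Nat.pair k i))
  have hφ : ∀ k, (coordHom f (n k)).ker ≤ (φ k).ker := by
    intro k g hg
    refine funext fun i => ?_
    have := hχ (Nat.pair k i)
    rw [Nat.unpair_pair] at this
    exact this hg
  have hW : ∀ k, W k ≤ coordKer f (s k) := by
    intro k
    rw [AddSubgroup.closure_le]
    rintro _ ⟨i, rfl⟩
    have := hw (Nat.pair k i)
    rwa [Nat.unpair_pair] at this
  have hφW : ∀ j k, j < k → W j ≤ (φ k).ker := by
    intro j k hjk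
    rw [AddSubgroup.closure_le]
    rintro _ ⟨i, rfl⟩
    refine funext fun i' => hχw _ _ fun h => ?_
    exact hjk.ne' (Nat.pair_eq_pair.1 h).1
  obtain ⟨L, hL, hLK⟩ := exists_prodDiscreteEmbeds_quotient hf hc hs φ
    (fun k => (coordKer_le_ker_coordHom f (hn k)).trans (hφ k)) W hW (fun j k hjk => by
      rw [(AddSubgroup.map_eq_bot_iff _).2 (hφW j k hjk)]; exact bot_le)
  refine ⟨L, hL, _, _, fun k => ?_, fun k => ?_, hLK⟩
  · refine Infinite.of_injective (fun i : ℕ => (⟨φ k (w (Nat.pair k i)), _,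
      AddSubgroup.subset_closure ⟨i, rfl⟩, rfl⟩ : (W k).map (φ k))) fun i j hij => ?_
    by_contra hne
    have h1 : χ (Nat.pair k i) (w (Nat.pair k i)) = χ (Nat.pair k i) (w (Nat.pair k j)) :=
      congrFun (congrArg Subtype.val hij) i
    exact hχ0 _ (h1.trans (hχw _ _ fun h => hne (Nat.pair_eq_pair.1 h).2))
  · have hP : IsPPrimaryGroup p ((W k).map (φ k)) := by
      refine isPPrimaryGroup_of_forall hp ?_
      rintro ⟨_, g, hg, rfl⟩
      obtain ⟨e, he⟩ := (hA (n k)).exists_pow_smul_eq_zero (coordHom f (n k) g)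
      refine ⟨e, Subtype.ext ?_⟩
      change p ^ e • φ k g = 0
      rw [← map_nsmul] at he ⊢
      exact hφ k he
    refine hP.isBoundedDscGroup hp ?_
    obtain ⟨M, hM, hMb⟩ := hb (n k)
    refine ⟨M, hM, ?_⟩
    rintro ⟨_, g, hg, rfl⟩
    refine Subtype.ext ?_
    have h0 : M • coordHom f (n k) g = 0 :=
      congrArg Subtype.val (hMb ⟨_, g, hN k (hW k hg), rfl⟩)
    change M • φ k g = 0
    rw [← map_nsmul] at h0 ⊢
    exact hφ k h0

/-! ### The dichotomy. -/

theorem IsDivisiblePGroupOfInfiniteRank.infinite {p : ℕ} {A : Type*} [AddCommGroup A]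
    (hA : IsDivisiblePGroupOfInfiniteRank p A) : Infinite A :=
  Cardinal.aleph0_le_mk_iff.1 (hA.2.2.trans (ciSup_le' fun S => Cardinal.mk_set_le S.1))

theorem mainTheorem4 {G : Type*} [AddCommGroup G] [TopologicalSpace G] [IsTopologicalAddGroup G]
    (p : ℕ) (hp : p.Prime) (hG : IsQuasiPReduced p G) (hlc : ¬ LocallyCompactSpace G) :
    ((∃ H : AddSubgroup G, IsOpen (H : Set G) ∧ IsQuasiBoundedDsc H) ∨
      (∃ L : AddSubgroup G, IsClosed (L : Set G) ∧
        ∃ (K : ℕ → Type) (_ : ∀ n, AddCommGroup (K n)),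
          (∀ n, IsDivisiblePGroupOfInfiniteRank p (K n)) ∧ ProdDiscreteEmbeds K (G ⧸ L))) ∧
    (∃ L : AddSubgroup G, IsClosed (L : Set G) ∧
      ∃ (K : ℕ → Type) (_ : ∀ n, AddCommGroup (K n)),
        (∀ n, Infinite (K n)) ∧
        ((∀ n, IsBoundedDscGroup (K n)) ∨ (∀ n, IsDivisiblePGroupOfInfiniteRank p (K n))) ∧
        ProdDiscreteEmbeds K (G ⧸ L)) := by
  obtain ⟨-, hPol, A, iA, hA, hcount, f, hf, -⟩ := hG
  let _ : ∀ n, TopologicalSpace (A n) := fun _ => ⊥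
  have : ∀ n, DiscreteTopology (A n) := fun _ => ⟨rfl⟩
  have : ∀ n, PolishSpace (A n) := fun n => inferInstance
  have hc : IsClosed (range f) := isClosed_range_of_isEmbedding_of_polishSpace f hf
  by_cases hb : ∃ s, ∀ n, IsBoundedGroup ((coordKer f s).map (coordHom f n))
  · obtain ⟨s, hs⟩ := hb
    have hAp := fun n => (hA n).1
    refine ⟨Or.inl ⟨coordKer f s, isOpen_coordKer hf.continuous s,
      isQuasiBoundedDsc_coordKer hp hAp hf hs⟩, ?_⟩
    obtain ⟨L, hL, K, iK, hinf, hK, hLK⟩ :=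
      exists_prodDiscreteEmbeds_boundedDsc hp hAp hf hc hlc hs
    exact ⟨L, hL, K, iK, hinf, Or.inl hK, hLK⟩
  · push Not at hb
    obtain ⟨L, hL, K, iK, hK, hLK⟩ := exists_prodDiscreteEmbeds_divisible hp hA hf hc hb
    exact ⟨Or.inr ⟨L, hL, K, iK, hK, hLK⟩, L, hL, K, iK, fun n => (hK n).infinite, Or.inr hK, hLK⟩
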